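/- There is a real number $z_0$ such that for every real $z \ge z_0$ the number of ordered pairs $(p,q)$ of primes with $z \le p, q < 2z$ (the case $p=q$ being allowed) and $\gcd(p-1,q-1) > \log z$ is at most $$\left(\frac{z}{\log z}\right)^2 \frac{(\log\log z)^2}{\log z}.$$ Consequently, pairs violating the condition "$2^{p-1}\not\equiv 1 \pmod q$ or $2^{q-1}\not\equiv 1 \pmod p$" are asymptotically rare: among all ordered pairs $(p,q)$ of primes with $z\le p,q<2z$, the proportion of those for which both $2^{p-1}\equiv 1 \pmod q$ and $2^{q-1}\equiv 1\pmod p$ is $o\!\left(\frac{(\log\log z)^2}{\log z}\right)$ as $z\to\infty$. -/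

import Mathlib

open Filter Asymptotics

/-- The (finite) set of primes `p` with `z ≤ p < 2z`, for real `z`; see `mem_dyadicPrimes`. -/
noncomputable def dyadicPrimes (z : ℝ) : Finset ℕ :=
  (Finset.Ico ⌈z⌉₊ ⌈2 * z⌉₊).filter Nat.Prime

theorem mem_dyadicPrimes {z : ℝ} {p : ℕ} :
    p ∈ dyadicPrimes z ↔ p.Prime ∧ z ≤ (p : ℝ) ∧ (p : ℝ) < 2 * z := by
  simp only [dyadicPrimes, Finset.mem_filter, Finset.mem_Ico, Nat.ceil_le, Nat.lt_ceil]
  tauto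

/-- All ordered pairs `(p, q)` of primes with `z ≤ p, q < 2z` (the case `p = q` is allowed). -/
noncomputable def primePairs (z : ℝ) : Finset (ℕ × ℕ) :=
  dyadicPrimes z ×ˢ dyadicPrimes z

open Classical in
/-- The ordered pairs `(p, q)` of primes with `z ≤ p, q < 2z` and `gcd (p - 1, q - 1) > log z`. -/
noncomputable def largeGcdPairs (z : ℝ) : Finset (ℕ × ℕ) :=
  (primePairs z).filter fun pq => Real.log z < (Nat.gcd (pq.1 - 1) (pq.2 - 1) : ℝ)

/-- The condition on a pair of primes `p, q` under which the factoring reduction applies directly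
to `n = p * q`. -/
def ReductionCondition (p q : ℕ) : Prop :=
  ¬ 2 ^ (p - 1) ≡ 1 [MOD q] ∨ ¬ 2 ^ (q - 1) ≡ 1 [MOD p]

open Classical in
/-- The ordered pairs `(p, q)` of primes with `z ≤ p, q < 2z` that violate that condition. -/
noncomputable def violatingPairs (z : ℝ) : Finset (ℕ × ℕ) :=
  (primePairs z).filter fun pq => ¬ ReductionCondition pq.1 pq.2

/-! If `g = gcd (p - 1, q - 1)`, then `p` and `q` are both `1` mod `g`. The number of pairs is
therefore at most the sum over `g > log z` of `N(g) ^ 2`, where `N(g)` counts the primes in `[z,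
2z)` congruent to `1` mod `g`.

Selberg's sieve (`selberg_sieve`) gives `N(g) ^ 2 ≪ (1 + log g) (z / (g log z)) ^ 2 + z` for `g ≤ z`
(`card_dyadicPrimesModOne_sq_le`). Summed over `log z < g ≤ (log z) ^ 3`, where `log g ≪ log log z`,
this is `O(z ^ 2 log log z / (log z) ^ 3)`. For larger `g` the trivial `N(g) ≤ z / g + 1` suffices.
The result beats the claim by a factor `log log z`, which absorbs every constant and yields the
little-o.

In a violating pair the order of `2` mod `q` divides `g`, so `z ≤ q < 2 ^ g` and `g > log z`. A
Chebyshev lower bound for the primes in `[z, 2z)` turns counts into proportions. -/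

/-! ### Selberg's upper bound sieve. -/

theorem sum_moebius_divisors_filter_dvd {n k : ℕ} (hn : Squarefree n) (hk : k ∣ n) :
    ∑ l ∈ n.divisors with k ∣ l, ArithmeticFunction.moebius l =
      if n = k then ArithmeticFunction.moebius k else 0 := by
  obtain ⟨m, rfl⟩ := hk
  have h0 : k * m ≠ 0 := hn.ne_zero
  have hk0 : k ≠ 0 := left_ne_zero_of_mul h0
  have hm0 : m ≠ 0 := right_ne_zero_of_mul h0
  have himg : (k * m).divisors.filter (k ∣ ·) = m.divisors.image (k * ·) := by
    ext l
    simp only [Finset.mem_filter, Nat.mem_divisors, Finset.mem_image]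
    constructor
    · rintro ⟨⟨h, -⟩, j, rfl⟩
      exact ⟨j, ⟨Nat.dvd_of_mul_dvd_mul_left (Nat.pos_of_ne_zero hk0) h, hm0⟩, rfl⟩
    · rintro ⟨j, ⟨hj, -⟩, rfl⟩
      exact ⟨⟨Nat.mul_dvd_mul_left k hj, h0⟩, dvd_mul_right _ _⟩
  rw [himg, Finset.sum_image fun a _ b _ h => Nat.eq_of_mul_eq_mul_left (Nat.pos_of_ne_zero hk0) h]
  have hcop : k.Coprime m := (Nat.squarefree_mul_iff.1 hn).1
  have hmul : ∀ j ∈ m.divisors, ArithmeticFunction.moebius (k * j) =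
      ArithmeticFunction.moebius k * ArithmeticFunction.moebius j := fun j hj =>
    ArithmeticFunction.isMultiplicative_moebius.map_mul_of_coprime
      (hcop.coprime_dvd_right (Nat.dvd_of_mem_divisors hj))
  rw [Finset.sum_congr rfl hmul, ← Finset.mul_sum, ← ArithmeticFunction.coe_zeta_mul_apply,
    ArithmeticFunction.coe_zeta_mul_moebius, ArithmeticFunction.one_apply]
  have hiff : k * m = k ↔ m = 1 := by
    constructor
    · intro h; exact Nat.eq_of_mul_eq_mul_left (Nat.pos_of_ne_zero hk0) (by rw [h, mul_one])
    · rintro rfl; exact mul_one k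
  simp [hiff]

/-- The weights of the Selberg sieve with support `S`. -/
noncomputable def selbergWeight (S : Finset ℕ) (l : ℕ) : ℝ :=
  ArithmeticFunction.moebius l * l * (∑ n ∈ S with l ∣ n, (Nat.totient n : ℝ)⁻¹) /
    ∑ n ∈ S, (Nat.totient n : ℝ)⁻¹

section Selberg

variable {S : Finset ℕ}

theorem sum_totient_inv_pos (h1 : 1 ∈ S) : 0 < ∑ n ∈ S, (Nat.totient n : ℝ)⁻¹ :=
  Finset.sum_pos' (fun _ _ => by positivity) ⟨1, h1, by simp⟩

theorem selbergWeight_one (h1 : 1 ∈ S) : selbergWeight S 1 = 1 := by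
  simp [selbergWeight, (sum_totient_inv_pos h1).ne']

/-- Cruder than the classical bound `1`, but enough, since the sieve level will be a small power of
`z`. -/
theorem abs_selbergWeight_le (h1 : 1 ∈ S) (l : ℕ) : |selbergWeight S l| ≤ l := by
  have hG := sum_totient_inv_pos h1
  rw [selbergWeight, abs_div, abs_of_pos hG, div_le_iff₀ hG, abs_mul, abs_mul, Nat.abs_cast,
    abs_of_nonneg (a := ∑ n ∈ S with l ∣ n, (Nat.totient n : ℝ)⁻¹)
      (Finset.sum_nonneg fun _ _ => by positivity)]
  have hmu : |(ArithmeticFunction.moebius l : ℝ)| ≤ 1 := by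
    exact_mod_cast ArithmeticFunction.abs_moebius_le_one
  have hs : ∑ n ∈ S with l ∣ n, (Nat.totient n : ℝ)⁻¹ ≤ ∑ n ∈ S, (Nat.totient n : ℝ)⁻¹ :=
    Finset.sum_le_sum_of_subset_of_nonneg (Finset.filter_subset _ _) fun _ _ _ => by positivity
  calc |(ArithmeticFunction.moebius l : ℝ)| * l * ∑ n ∈ S with l ∣ n, (Nat.totient n : ℝ)⁻¹
      ≤ 1 * l * ∑ n ∈ S, (Nat.totient n : ℝ)⁻¹ := by gcongr
    _ = _ := by rw [one_mul]

/-- By Möbius inversion over multiples, these are the diagonal coordinates of the weights, at which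
the quadratic form of the sieve is minimal subject to weight `1` at `1`. -/
theorem sum_selbergWeight_div (hsq : ∀ l ∈ S, Squarefree l) (hdvd : ∀ l ∈ S, ∀ k, k ∣ l → k ∈ S)
    {k : ℕ} (hk : k ∈ S) :
    ∑ l ∈ S with k ∣ l, selbergWeight S l / l =
      ArithmeticFunction.moebius k * (Nat.totient k : ℝ)⁻¹ / ∑ n ∈ S, (Nat.totient n : ℝ)⁻¹ := by
  have hpt : ∀ l ∈ S.filter (k ∣ ·), selbergWeight S l / l =
      (∑ n ∈ S, if l ∣ n then (ArithmeticFunction.moebius l : ℝ) * (Nat.totient n : ℝ)⁻¹ else 0) /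
        ∑ n ∈ S, (Nat.totient n : ℝ)⁻¹ := by
    intro l hl
    have hl0 : (l : ℝ) ≠ 0 := by exact_mod_cast (hsq l (Finset.mem_filter.1 hl).1).ne_zero
    rw [selbergWeight, ← Finset.sum_filter, ← Finset.mul_sum]
    field_simp
  rw [Finset.sum_congr rfl hpt, ← Finset.sum_div, Finset.sum_comm]
  congr 1
  have hin : ∀ n ∈ S, (∑ l ∈ S with k ∣ l,
      if l ∣ n then (ArithmeticFunction.moebius l : ℝ) * (Nat.totient n : ℝ)⁻¹ else 0) =
      if n = k then (ArithmeticFunction.moebius k : ℝ) * (Nat.totient k : ℝ)⁻¹ else 0 := by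
    intro n hn
    rw [← Finset.sum_filter, ← Finset.sum_mul]
    have hset : (S.filter (k ∣ ·)).filter (· ∣ n) = n.divisors.filter (k ∣ ·) := by
      ext l
      simp only [Finset.mem_filter, Nat.mem_divisors]
      exact ⟨fun h => ⟨⟨h.2, (hsq n hn).ne_zero⟩, h.1.2⟩,
        fun h => ⟨⟨hdvd n hn l h.1.1, h.2⟩, h.1.1⟩⟩
    rw [hset]
    by_cases hkn : k ∣ n
    · have := sum_moebius_divisors_filter_dvd (hsq n hn) hkn
      rw [← Int.cast_sum, this]
      split_ifs with h
      · rw [h]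
      · simp
    · rw [if_neg (fun h : n = k => hkn h.symm.dvd), Finset.filter_false_of_mem, Finset.sum_empty,
        zero_mul]
      intro l hl h
      exact hkn (h.trans (Nat.dvd_of_mem_divisors hl))
  rw [Finset.sum_congr rfl hin, Finset.sum_ite_eq' S k]
  simp [hk]

/-- Since `1 / lcm a b = gcd a b / (a b)` and `gcd a b` is the sum of `φ k` over common divisors
`k`, the form becomes a sum of `φ k` times squares. -/
theorem sum_selbergWeight_mul_div_lcm (h1 : 1 ∈ S) (hsq : ∀ l ∈ S, Squarefree l)
    (hdvd : ∀ l ∈ S, ∀ k, k ∣ l → k ∈ S) :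
    ∑ a ∈ S, ∑ b ∈ S, selbergWeight S a * selbergWeight S b / (Nat.lcm a b : ℝ) =
      (∑ n ∈ S, (Nat.totient n : ℝ)⁻¹)⁻¹ := by
  have hG := sum_totient_inv_pos h1
  have hterm : ∀ a ∈ S, ∀ b ∈ S, selbergWeight S a * selbergWeight S b / (Nat.lcm a b : ℝ) =
      ∑ k ∈ S, (Nat.totient k : ℝ) * ((if k ∣ a then selbergWeight S a / a else 0) *
        (if k ∣ b then selbergWeight S b / b else 0)) := by
    intro a ha b hb
    have ha0 : a ≠ 0 := (hsq a ha).ne_zero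
    have hb0 : b ≠ 0 := (hsq b hb).ne_zero
    have hset : S.filter (fun k => k ∣ a ∧ k ∣ b) = (Nat.gcd a b).divisors := by
      ext k
      simp only [Finset.mem_filter, Nat.mem_divisors, Nat.dvd_gcd_iff]
      exact ⟨fun h => ⟨h.2, Nat.gcd_ne_zero_left ha0⟩, fun h => ⟨hdvd a ha k h.1.1, h.1⟩⟩
    have hsum : ∑ k ∈ S with k ∣ a ∧ k ∣ b, (Nat.totient k : ℝ) = Nat.gcd a b := by
      rw [hset, ← Nat.cast_sum, Nat.sum_totient]
    have hite : ∀ k, (Nat.totient k : ℝ) * ((if k ∣ a then selbergWeight S a / a else 0) *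
        (if k ∣ b then selbergWeight S b / b else 0)) =
        if k ∣ a ∧ k ∣ b then
          (Nat.totient k : ℝ) * (selbergWeight S a / a * (selbergWeight S b / b)) else 0 := by
      intro k
      split_ifs <;> simp_all
    simp_rw [hite]
    rw [← Finset.sum_filter, ← Finset.sum_mul, hsum]
    have hgl : (Nat.gcd a b : ℝ) * Nat.lcm a b = a * b := by exact_mod_cast Nat.gcd_mul_lcm a b
    have hl0 : (Nat.lcm a b : ℝ) ≠ 0 := by exact_mod_cast Nat.lcm_ne_zero ha0 hb0
    have : (a : ℝ) ≠ 0 := by exact_mod_cast ha0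
    have : (b : ℝ) ≠ 0 := by exact_mod_cast hb0
    field_simp
    linear_combination -(selbergWeight S a * selbergWeight S b) * hgl
  rw [Finset.sum_congr rfl fun a ha => Finset.sum_congr rfl (hterm a ha)]
  rw [Finset.sum_congr rfl fun a _ => Finset.sum_comm, Finset.sum_comm]
  have hk : ∀ k ∈ S, (∑ a ∈ S, ∑ b ∈ S, (Nat.totient k : ℝ) *
      ((if k ∣ a then selbergWeight S a / a else 0) *
        (if k ∣ b then selbergWeight S b / b else 0))) =
      (Nat.totient k : ℝ)⁻¹ / (∑ n ∈ S, (Nat.totient n : ℝ)⁻¹) ^ 2 := by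
    intro k hkS
    simp_rw [← Finset.mul_sum]
    rw [← Finset.sum_mul, ← Finset.sum_filter, sum_selbergWeight_div hsq hdvd hkS]
    have hmu : (ArithmeticFunction.moebius k : ℝ) ^ 2 = 1 := by
      exact_mod_cast ArithmeticFunction.moebius_sq_eq_one_of_squarefree (hsq k hkS)
    have hphi : (Nat.totient k : ℝ) ≠ 0 := by
      exact_mod_cast (Nat.totient_pos.2 (Nat.pos_of_ne_zero (hsq k hkS).ne_zero)).ne'
    field_simp
    rw [hmu]
  rw [Finset.sum_congr rfl hk, ← Finset.sum_div]
  field_simp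

/-- **Selberg's upper bound sieve** for a finite divisor-closed set `S` of squarefree moduli. -/
theorem selberg_sieve {ι : Type*} (A : Finset ι) (f : ι → ℕ) {R : ℕ} {X : ℝ} (h1 : 1 ∈ S)
    (hsq : ∀ l ∈ S, Squarefree l) (hdvd : ∀ l ∈ S, ∀ k, k ∣ l → k ∈ S) (hR : ∀ l ∈ S, l ≤ R)
    (hA : ∀ k ∈ S, ∀ l ∈ S,
      |((A.filter fun i => Nat.lcm k l ∣ f i).card : ℝ) - X / (Nat.lcm k l : ℝ)| ≤ 1) :
    ((A.filter fun i => ∀ l ∈ S, l ∣ f i → l = 1).card : ℝ) ≤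
      X / (∑ n ∈ S, (Nat.totient n : ℝ)⁻¹) + (R : ℝ) ^ 4 := by
  set w := selbergWeight S
  -- The square is nonnegative everywhere, and equals `1` at a sifted element because only `l = 1`
  -- contributes.
  have hpt : ((A.filter fun i => ∀ l ∈ S, l ∣ f i → l = 1).card : ℝ) ≤
      ∑ i ∈ A, (∑ l ∈ S, if l ∣ f i then w l else 0) ^ 2 := by
    rw [Finset.card_eq_sum_ones, Nat.cast_sum, Finset.sum_filter]
    refine Finset.sum_le_sum fun i _ => ?_
    split_ifs with h
    · have : (∑ l ∈ S, if l ∣ f i then w l else 0) = 1 := by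
        rw [Finset.sum_eq_single_of_mem 1 h1]
        · simpa using selbergWeight_one h1
        · intro l hl hl1
          exact if_neg fun hd => hl1 (h l hl hd)
      rw [this]; simp
    · positivity
  have hexp : ∑ i ∈ A, (∑ l ∈ S, if l ∣ f i then w l else 0) ^ 2 =
      ∑ k ∈ S, ∑ l ∈ S, w k * w l * ((A.filter fun i => Nat.lcm k l ∣ f i).card : ℝ) := by
    have : ∀ i ∈ A, (∑ l ∈ S, if l ∣ f i then w l else 0) ^ 2 =
        ∑ k ∈ S, ∑ l ∈ S, if Nat.lcm k l ∣ f i then w k * w l else 0 := by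
      intro i _
      rw [sq, Finset.sum_mul_sum]
      refine Finset.sum_congr rfl fun k _ => Finset.sum_congr rfl fun l _ => ?_
      simp only [Nat.lcm_dvd_iff]
      split_ifs <;> simp_all
    rw [Finset.sum_congr rfl this, Finset.sum_comm]
    refine Finset.sum_congr rfl fun k _ => ?_
    rw [Finset.sum_comm]
    refine Finset.sum_congr rfl fun l _ => ?_
    rw [← Finset.sum_filter, Finset.sum_const, nsmul_eq_mul, mul_comm]
  have hmain : ∑ k ∈ S, ∑ l ∈ S, w k * w l * (X / (Nat.lcm k l : ℝ)) =
      X / ∑ n ∈ S, (Nat.totient n : ℝ)⁻¹ := by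
    rw [div_eq_mul_inv X, ← sum_selbergWeight_mul_div_lcm h1 hsq hdvd, Finset.mul_sum]
    refine Finset.sum_congr rfl fun k _ => ?_
    rw [Finset.mul_sum]
    exact Finset.sum_congr rfl fun l _ => by ring
  have hcard : (S.card : ℝ) ≤ R := by
    have hsub : S ⊆ Finset.Icc 1 R := fun l hl =>
      Finset.mem_Icc.2 ⟨Nat.pos_of_ne_zero (hsq l hl).ne_zero, hR l hl⟩
    have := Finset.card_le_card hsub
    rw [Nat.card_Icc, Nat.add_sub_cancel] at this
    exact_mod_cast this
  have hw : ∀ l ∈ S, |w l| ≤ R := fun l hl =>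
    (abs_selbergWeight_le h1 l).trans (by exact_mod_cast hR l hl)
  have herr : ∑ k ∈ S, ∑ l ∈ S,
      w k * w l * (((A.filter fun i => Nat.lcm k l ∣ f i).card : ℝ) - X / (Nat.lcm k l : ℝ)) ≤
        (R : ℝ) ^ 4 := by
    calc _ ≤ ∑ k ∈ S, ∑ l ∈ S, (R : ℝ) * R := by
          refine Finset.sum_le_sum fun k hk => Finset.sum_le_sum fun l hl => ?_
          refine (le_abs_self _).trans ?_
          rw [abs_mul, abs_mul]
          calc _ ≤ (R : ℝ) * R * 1 := by
                gcongr
                exacts [hw k hk, hw l hl, hA k hk l hl]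
            _ = _ := mul_one _
      _ = (S.card : ℝ) * (S.card * (R * R)) := by simp
      _ ≤ (R : ℝ) * (R * (R * R)) := by gcongr
      _ = _ := by ring
  calc _ ≤ _ := hpt
    _ = _ := hexp
    _ = ∑ k ∈ S, ∑ l ∈ S, w k * w l * (X / (Nat.lcm k l : ℝ)) + ∑ k ∈ S, ∑ l ∈ S,
        w k * w l * (((A.filter fun i => Nat.lcm k l ∣ f i).card : ℝ) - X / (Nat.lcm k l : ℝ)) := by
      simp_rw [← Finset.sum_add_distrib]
      exact Finset.sum_congr rfl fun k _ => Finset.sum_congr rfl fun l _ => by ring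
    _ ≤ _ := by rw [hmain]; gcongr

end Selberg

/-! ### Lower bound for the sieve denominator. -/

/-- The squarefree integers up to `R` that are coprime to `d`. -/
def squarefreeCoprime (d R : ℕ) : Finset ℕ :=
  (Finset.Icc 1 R).filter fun l => Squarefree l ∧ l.Coprime d

theorem mem_squarefreeCoprime {d R l : ℕ} :
    l ∈ squarefreeCoprime d R ↔ l ≤ R ∧ Squarefree l ∧ l.Coprime d := by
  simp only [squarefreeCoprime, Finset.mem_filter, Finset.mem_Icc]
  exact ⟨fun h => ⟨h.1.2, h.2⟩, fun h => ⟨⟨Nat.pos_of_ne_zero h.2.1.ne_zero, h.1⟩, h.2⟩⟩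

theorem sum_Icc_inv_sq_le_two (R : ℕ) : ∑ a ∈ Finset.Icc 1 R, ((a : ℝ) ^ 2)⁻¹ ≤ 2 := by
  rcases Nat.eq_zero_or_pos R with rfl | hR
  · simp
  · rw [← Finset.add_sum_Ioc_eq_sum_Icc hR]
    have := sum_Ioc_inv_sq_le_sub (α := ℝ) one_ne_zero hR
    have h : (0 : ℝ) ≤ (R : ℝ)⁻¹ := by positivity
    norm_num at this ⊢
    linarith

/-- Write `n = a ^ 2 * b` with `b` squarefree and split off `gcd b d`, which is recorded by its set
of primes. -/
theorem exists_sq_mul_prod_mul {d R n : ℕ} (hd : d ≠ 0) (hn : n ∈ Finset.Icc 1 R) :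
    ∃ x ∈ Finset.Icc 1 R ×ˢ (d.primeFactors.powerset ×ˢ squarefreeCoprime d R),
      x.1 ^ 2 * ((∏ p ∈ x.2.1, p) * x.2.2) = n := by
  obtain ⟨hn1, hnR⟩ := Finset.mem_Icc.1 hn
  obtain ⟨b, a, rfl, hb⟩ := Nat.sq_mul_squarefree n
  have hb0 : b ≠ 0 := hb.ne_zero
  have ha0 : a ≠ 0 := by rintro rfl; simp at hn1
  set g := Nat.gcd b d with hg
  have hg0 : g ≠ 0 := Nat.gcd_ne_zero_left hb0
  obtain ⟨c, hc⟩ : g ∣ b := Nat.gcd_dvd_left b d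
  have hsq : Squarefree (g * c) := hc ▸ hb
  have hgc := (Nat.squarefree_mul_iff.1 hsq)
  have hc0 : c ≠ 0 := hgc.2.2.ne_zero
  have hble : b ≤ R := (Nat.le_mul_of_pos_left b (by positivity)).trans hnR
  refine ⟨(a, (g.primeFactors, c)), ?_, ?_⟩
  · simp only [Finset.mem_product, Finset.mem_Icc, Finset.mem_powerset, mem_squarefreeCoprime]
    refine ⟨⟨Nat.pos_of_ne_zero ha0, ?_⟩, Nat.primeFactors_mono (Nat.gcd_dvd_right b d) hd, ?_,
      hgc.2.2, ?_⟩
    · calc a ≤ a ^ 2 := Nat.le_self_pow two_ne_zero a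
        _ ≤ a ^ 2 * b := Nat.le_mul_of_pos_right _ (Nat.pos_of_ne_zero hb0)
        _ ≤ R := hnR
    · exact (Nat.le_of_dvd (Nat.pos_of_ne_zero hb0) (hc ▸ dvd_mul_left c g)).trans hble
    · have h1 : Nat.gcd c d ∣ g :=
        Nat.dvd_gcd ((Nat.gcd_dvd_left c d).trans (hc ▸ dvd_mul_left c g)) (Nat.gcd_dvd_right c d)
      exact Nat.eq_one_of_dvd_coprimes hgc.1 h1 (Nat.gcd_dvd_left c d)
  · simp only [Nat.prod_primeFactors_of_squarefree hgc.2.1]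
    rw [← hc]

/-- The factorization above embeds the harmonic sum up to `R` in a product of three sums: inverse
squares (at most `2`), the expanded product over primes of `d`, and inverse totients. -/
theorem log_le_sum_totient_inv {d : ℕ} (hd : d ≠ 0) (R : ℕ) :
    Real.log (R + 1) ≤ 2 * ((∏ p ∈ d.primeFactors, (1 + (p : ℝ)⁻¹)) *
      ∑ l ∈ squarefreeCoprime d R, (Nat.totient l : ℝ)⁻¹) := by
  have hharm : Real.log (R + 1) ≤ ∑ n ∈ Finset.Icc 1 R, (n : ℝ)⁻¹ := by
    have := log_add_one_le_harmonic R
    rw [harmonic_eq_sum_Icc] at this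
    push_cast at this
    exact this
  choose! φ hφT hφ using fun n (hn : n ∈ Finset.Icc 1 R) => exists_sq_mul_prod_mul hd hn
  set T := Finset.Icc 1 R ×ˢ (d.primeFactors.powerset ×ˢ squarefreeCoprime d R)
  let g : ℕ × (Finset ℕ × ℕ) → ℝ := fun x =>
    ((x.1 : ℝ) ^ 2)⁻¹ * ((∏ p ∈ x.2.1, (p : ℝ)⁻¹) * (Nat.totient x.2.2 : ℝ)⁻¹)
  have hinj : Set.InjOn φ (Finset.Icc 1 R) := fun a ha b hb hab => by
    rw [← hφ a ha, ← hφ b hb, hab]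
  have hle : ∑ n ∈ Finset.Icc 1 R, (n : ℝ)⁻¹ ≤ ∑ x ∈ T, g x := by
    calc ∑ n ∈ Finset.Icc 1 R, (n : ℝ)⁻¹ ≤ ∑ n ∈ Finset.Icc 1 R, g (φ n) := by
          refine Finset.sum_le_sum fun n hn => ?_
          have hmem := hφT n hn
          simp only [T, Finset.mem_product, mem_squarefreeCoprime] at hmem
          have hpos : 0 < Nat.totient (φ n).2.2 :=
            Nat.totient_pos.2 (Nat.pos_of_ne_zero hmem.2.2.2.1.ne_zero)
          conv_lhs => rw [← hφ n hn]
          simp only [g]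
          push_cast
          rw [mul_inv, mul_inv, Finset.prod_inv_distrib]
          gcongr
          exact Nat.totient_le _
      _ = ∑ x ∈ (Finset.Icc 1 R).image φ, g x := (Finset.sum_image hinj).symm
      _ ≤ ∑ x ∈ T, g x := by
          refine Finset.sum_le_sum_of_subset_of_nonneg ?_ fun x _ _ => by
            simp only [g]
            have := Finset.prod_nonneg (s := x.2.1) (f := fun p : ℕ => (p : ℝ)⁻¹)
              fun _ _ => by positivity
            positivity
          intro x hx
          obtain ⟨n, hn, rfl⟩ := Finset.mem_image.1 hx
          exact hφT n hn
  have hT : ∑ x ∈ T, g x = (∑ a ∈ Finset.Icc 1 R, ((a : ℝ) ^ 2)⁻¹) *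
      ((∏ p ∈ d.primeFactors, (1 + (p : ℝ)⁻¹)) *
        ∑ l ∈ squarefreeCoprime d R, (Nat.totient l : ℝ)⁻¹) := by
    rw [Finset.prod_one_add, Finset.sum_mul_sum, ← Finset.sum_product', Finset.sum_mul_sum,
      ← Finset.sum_product']
  refine hharm.trans (hle.trans (hT.trans_le ?_))
  gcongr
  exact sum_Icc_inv_sq_le_two R

/-! ### The product of `1 + 1/p` over the primes dividing `d`. -/

/-- A weak form of Mertens. Of two consecutive integers above `2` at most one is prime, so the
induction goes two steps back when the top is prime, using `(m + 5) ^ 2 * (m + 2) ≤ (m + 4) ^ 3`. -/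
theorem prod_primesLE_one_add_inv_sq_le (n : ℕ) :
    (∏ p ∈ (Finset.Icc 1 (n + 1)).filter Nat.Prime, (1 + (p : ℝ)⁻¹)) ^ 2 ≤ 4 * (n + 1) := by
  induction n using Nat.strong_induction_on with
  | _ n ih =>
    match n, ih with
    | 0, _ =>
      rw [show (Finset.Icc 1 (0 + 1)).filter Nat.Prime = ∅ by decide]
      norm_num
    | 1, _ =>
      rw [show (Finset.Icc 1 (1 + 1)).filter Nat.Prime = {2} by decide]
      norm_num
    | 2, _ =>
      rw [show (Finset.Icc 1 (2 + 1)).filter Nat.Prime = {2, 3} by decide]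
      norm_num
    | m + 3, ih =>
      have hstep : ∀ k : ℕ, (Finset.Icc 1 (k + 1)).filter Nat.Prime =
          if (k + 1).Prime then insert (k + 1) ((Finset.Icc 1 k).filter Nat.Prime)
          else (Finset.Icc 1 k).filter Nat.Prime := by
        intro k
        rw [← Finset.insert_Icc_right_eq_Icc_add_one (Nat.le_add_left 1 k), Finset.filter_insert]
      by_cases hp : (m + 3 + 1).Prime
      · have hev : ¬ (m + 2 + 1).Prime := by
          intro h
          have h2 := hp.eq_two_or_odd
          have h3 := h.eq_two_or_odd
          omega
        rw [hstep, if_pos hp, hstep (m + 2), if_neg hev, Finset.prod_insert (by simp), mul_pow]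
        have := ih (m + 1) (by omega)
        calc _ ≤ (1 + ((m + 3 + 1 : ℕ) : ℝ)⁻¹) ^ 2 * (4 * ((m + 1 : ℕ) + 1)) := by gcongr
          _ ≤ _ := by
            push_cast
            have hm : (0 : ℝ) ≤ m := by positivity
            rw [show (1 + ((m : ℝ) + 3 + 1)⁻¹) = (m + 5) / (m + 4) by field_simp; ring, div_pow,
              div_mul_eq_mul_div, div_le_iff₀ (by positivity)]
            nlinarith [pow_nonneg hm 2, pow_nonneg hm 3]
      · rw [hstep, if_neg hp]
        refine (ih (m + 2) (by omega)).trans ?_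
        push_cast; linarith

/-- Let `w ≪ log d` be the number of prime factors. Those up to `w + 1` fall under the previous
bound; the at most `w` larger ones contribute at most `(1 + 1/(w+1)) ^ w ≤ e`. -/
theorem prod_primeFactors_one_add_inv_sq_le {d : ℕ} (hd : d ≠ 0) :
    (∏ p ∈ d.primeFactors, (1 + (p : ℝ)⁻¹)) ^ 2 ≤ 50 * (1 + Real.log d) := by
  set w := d.primeFactors.card with hw
  have hwlog : (w : ℝ) ≤ 3 / 2 * Real.log d := by
    have h1 : 2 ^ w ≤ d := by
      calc 2 ^ w ≤ ∏ p ∈ d.primeFactors, p :=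
            Finset.pow_card_le_prod _ _ _ fun p hp => (Nat.prime_of_mem_primeFactors hp).two_le
        _ ≤ d := Nat.le_of_dvd (Nat.pos_of_ne_zero hd) (Nat.prod_primeFactors_dvd d)
    have h2 : (w : ℝ) * Real.log 2 ≤ Real.log d := by
      rw [← Real.log_pow]
      exact Real.log_le_log (by positivity) (by exact_mod_cast h1)
    have := Real.log_two_gt_d9
    have hw0 : (0 : ℝ) ≤ w := by positivity
    nlinarith
  rw [← Finset.prod_filter_mul_prod_filter_not d.primeFactors (· ≤ w + 1), mul_pow]
  have hsmall : (∏ p ∈ d.primeFactors with p ≤ w + 1, (1 + (p : ℝ)⁻¹)) ^ 2 ≤ 4 * (w + 1) := by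
    refine le_trans ?_ (prod_primesLE_one_add_inv_sq_le w)
    refine pow_le_pow_left₀ (Finset.prod_nonneg fun _ _ => by positivity) ?_ 2
    refine Finset.prod_le_prod_of_subset_of_one_le ?_ (fun _ _ => by positivity) ?_
    · intro p hp
      have := Finset.mem_filter.1 hp
      have hpp := Nat.prime_of_mem_primeFactors this.1
      exact Finset.mem_filter.2 ⟨Finset.mem_Icc.2 ⟨hpp.one_lt.le, this.2⟩, hpp⟩
    · intro p _ _
      exact le_add_of_nonneg_right (by positivity)
  have hbig : ∏ p ∈ d.primeFactors with ¬ p ≤ w + 1, (1 + (p : ℝ)⁻¹) ≤ Real.exp 1 := by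
    calc _ ≤ ∏ p ∈ d.primeFactors with ¬ p ≤ w + 1, Real.exp ((w + 1 : ℝ)⁻¹) := by
          refine Finset.prod_le_prod (fun _ _ => by positivity) fun p hp => ?_
          have hpw : (w + 1 : ℝ) ≤ p := by
            exact_mod_cast (not_le.1 (Finset.mem_filter.1 hp).2).le
          calc (1 + (p : ℝ)⁻¹) ≤ 1 + (w + 1 : ℝ)⁻¹ := by gcongr
            _ ≤ _ := by rw [add_comm]; exact Real.add_one_le_exp _
      _ = Real.exp ((d.primeFactors.filter fun p => ¬ p ≤ w + 1).card * (w + 1 : ℝ)⁻¹) := by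
          rw [Finset.prod_const, ← Real.exp_nat_mul]
      _ ≤ Real.exp 1 := by
          apply Real.exp_le_exp.2
          rw [← div_eq_mul_inv, div_le_one (by positivity)]
          have : (d.primeFactors.filter fun p => ¬ p ≤ w + 1).card ≤ w :=
            Finset.card_filter_le _ _
          have : ((d.primeFactors.filter fun p => ¬ p ≤ w + 1).card : ℝ) ≤ w := by
            exact_mod_cast this
          linarith
  have he : Real.exp 1 ^ 2 ≤ 8 := by
    have := Real.exp_one_lt_d9
    have := Real.exp_pos 1
    nlinarith
  calc _ ≤ (4 * (w + 1 : ℝ)) * Real.exp 1 ^ 2 := by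
        gcongr
    _ ≤ (4 * (3 / 2 * Real.log d + 1)) * 8 := by gcongr
    _ ≤ _ := by
      have := Real.log_natCast_nonneg d
      linarith

/-! ### Primes congruent to `1` mod `g` in `[z, 2z)`. -/

theorem abs_card_Ico_filter_dvd_sub_le {a b d l : ℕ} (hab : a ≤ b) (hl : l ≠ 0)
    (hdl : d.Coprime l) :
    |(((Finset.Ico a b).filter fun m => l ∣ d * m + 1).card : ℝ) - ((b : ℝ) - a) / l| ≤ 1 := by
  have : NeZero l := ⟨hl⟩
  -- As `d` is invertible mod `l`, the condition selects the single residue class of `-1/d`.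
  set c : ℕ := (-(d : ZMod l)⁻¹).val with hc
  have hiff : ∀ m, l ∣ d * m + 1 ↔ m ≡ c [MOD l] := by
    intro m
    rw [← ZMod.natCast_eq_zero_iff, ← ZMod.natCast_eq_natCast_iff, hc, ZMod.natCast_zmod_val]
    have hu := ZMod.coe_mul_inv_eq_one d hdl
    push_cast
    constructor
    · intro h
      linear_combination ((d : ZMod l)⁻¹) * h - (m : ZMod l) * hu
    · intro h
      linear_combination (d : ZMod l) * h - hu
  simp_rw [hiff]
  have hcard := Nat.Ico_filter_modEq_card (a := a) (b := b) (r := l) (Nat.pos_of_ne_zero hl) c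
  have hl0 : (0 : ℝ) < l := by exact_mod_cast Nat.pos_of_ne_zero hl
  set N := ((Finset.Ico a b).filter fun m => m ≡ c [MOD l]).card
  set x : ℚ := ((b : ℚ) - c) / l with hx
  set y : ℚ := ((a : ℚ) - c) / l with hy
  have hyx : y ≤ x := by
    have : (a : ℚ) ≤ b := by exact_mod_cast hab
    rw [hx, hy]; gcongr
  have hxy : x - y = ((b : ℚ) - a) / l := by rw [hx, hy]; ring
  have hmax : max (⌈x⌉ - ⌈y⌉) 0 = ⌈x⌉ - ⌈y⌉ :=
    max_eq_left (sub_nonneg.2 (Int.ceil_mono hyx))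
  have hN : (N : ℤ) = ⌈x⌉ - ⌈y⌉ := hcard.trans hmax
  have hNq : (N : ℚ) = ⌈x⌉ - ⌈y⌉ := by exact_mod_cast hN
  have key : |(N : ℚ) - ((b : ℚ) - a) / l| ≤ 1 := by
    rw [← hxy, hNq, abs_le]
    have := Int.le_ceil x
    have := Int.le_ceil y
    have := Int.ceil_lt_add_one x
    have := Int.ceil_lt_add_one y
    constructor <;> linarith
  have key' := (Rat.cast_le (K := ℝ)).2 key
  push_cast at key'
  exact key'

/-- The primes `p` with `z ≤ p < 2z` and `p ≡ 1` modulo `g`. -/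
noncomputable def dyadicPrimesModOne (z : ℝ) (g : ℕ) : Finset ℕ :=
  (dyadicPrimes z).filter fun p => g ∣ p - 1

theorem exists_Ico_card_dyadicPrimesModOne_le {z : ℝ} (hz : 1 ≤ z) {g : ℕ} (hg : g ≠ 0) :
    ∃ a b : ℕ, a ≤ b ∧ (b : ℝ) - a ≤ z / g + 1 ∧ (dyadicPrimesModOne z g).card ≤
      ((Finset.Ico a b).filter fun m => (g * m + 1).Prime ∧ z ≤ ((g * m + 1 : ℕ) : ℝ)).card := by
  have hg0 : (0 : ℝ) < g := by exact_mod_cast Nat.pos_of_ne_zero hg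
  refine ⟨⌈(z - 1) / g⌉₊, ⌈(2 * z - 1) / g⌉₊, ?_, ?_, ?_⟩
  · apply Nat.ceil_mono; gcongr; linarith
  · have h1 := Nat.ceil_lt_add_one (a := (2 * z - 1) / g) (by apply div_nonneg <;> linarith)
    have h2 := Nat.le_ceil ((z - 1) / g)
    have h3 : (2 * z - 1) / g - (z - 1) / g = z / g := by ring
    linarith
  · have hform : ∀ p ∈ dyadicPrimesModOne z g, g * ((p - 1) / g) + 1 = p := by
      intro p hp
      obtain ⟨hp1, hp2⟩ := Finset.mem_filter.1 hp
      rw [Nat.mul_div_cancel' hp2]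
      exact Nat.sub_add_cancel (mem_dyadicPrimes.1 hp1).1.one_lt.le
    refine Finset.card_le_card_of_injOn (fun p => (p - 1) / g) ?_ ?_
    · intro p hp
      have hf := hform p hp
      obtain ⟨hpp, h1, h2⟩ := mem_dyadicPrimes.1 (Finset.mem_filter.1 hp).1
      have hfr : (g : ℝ) * (((p - 1) / g : ℕ) : ℝ) + 1 = p := by exact_mod_cast hf
      simp only [Finset.coe_filter, Finset.mem_Ico, Set.mem_ofPred_eq, hf]
      refine ⟨⟨?_, ?_⟩, hpp, h1⟩
      · rw [Nat.ceil_le, div_le_iff₀ hg0]; linarith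
      · rw [Nat.lt_ceil, lt_div_iff₀ hg0]; linarith
    · intro p hp q hq h
      rw [← hform p hp, ← hform q hq]
      simp only at h
      rw [h]

theorem card_dyadicPrimesModOne_le {z : ℝ} (hz : 1 ≤ z) {g : ℕ} (hg : g ≠ 0) :
    ((dyadicPrimesModOne z g).card : ℝ) ≤ z / g + 1 := by
  obtain ⟨a, b, hab, hX, hcard⟩ := exists_Ico_card_dyadicPrimesModOne_le hz hg
  refine le_trans ?_ hX
  rw [← Nat.cast_sub hab, ← Nat.card_Ico]
  exact_mod_cast hcard.trans (Finset.card_filter_le _ _)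

theorem card_dyadicPrimesModOne_le_sieve {z : ℝ} (hz : 1 ≤ z) {g R : ℕ} (hg : g ≠ 0)
    (hR : 1 ≤ R) (hRz : (R : ℝ) < z) :
    ((dyadicPrimesModOne z g).card : ℝ) ≤
      (z / g + 1) * (2 * ∏ p ∈ g.primeFactors, (1 + (p : ℝ)⁻¹)) / Real.log (R + 1) +
        (R : ℝ) ^ 4 := by
  obtain ⟨a, b, hab, hX, hcard⟩ := exists_Ico_card_dyadicPrimesModOne_le hz hg
  set S := squarefreeCoprime g R
  have h1 : 1 ∈ S := mem_squarefreeCoprime.2 ⟨hR, squarefree_one, Nat.coprime_one_left g⟩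
  have hdvd : ∀ l ∈ S, ∀ k, k ∣ l → k ∈ S := by
    intro l hl k hk
    obtain ⟨h2, h3, h4⟩ := mem_squarefreeCoprime.1 hl
    exact mem_squarefreeCoprime.2 ⟨(Nat.le_of_dvd (Nat.pos_of_ne_zero h3.ne_zero) hk).trans h2,
      h3.squarefree_of_dvd hk, h4.coprime_dvd_left hk⟩
  have hsieve := selberg_sieve (S := S) (Finset.Ico a b) (fun m => g * m + 1) (R := R)
    (X := (b : ℝ) - a) h1 (fun l hl => (mem_squarefreeCoprime.1 hl).2.1) hdvd
    (fun l hl => (mem_squarefreeCoprime.1 hl).1) (by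
      intro k hk l hl
      obtain ⟨-, hk2, hk3⟩ := mem_squarefreeCoprime.1 hk
      obtain ⟨-, hl2, hl3⟩ := mem_squarefreeCoprime.1 hl
      exact abs_card_Ico_filter_dvd_sub_le hab (Nat.lcm_ne_zero hk2.ne_zero hl2.ne_zero)
        (Nat.Coprime.coprime_dvd_right (Nat.lcm_dvd_mul k l)
          (Nat.Coprime.mul_right hk3.symm hl3.symm)))
  -- A prime `g * m + 1 ≥ z > R` has no divisor in `S` except `1`.
  have hsub : ((Finset.Ico a b).filter
      fun m => (g * m + 1).Prime ∧ z ≤ ((g * m + 1 : ℕ) : ℝ)).card ≤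
      ((Finset.Ico a b).filter fun m => ∀ l ∈ S, l ∣ g * m + 1 → l = 1).card := by
    refine Finset.card_le_card (Finset.monotone_filter_right _ ?_)
    rintro m _ ⟨hp, hzm⟩ l hl hlm
    refine (hp.eq_one_or_self_of_dvd l hlm).resolve_right fun h => ?_
    have hlR : (l : ℝ) ≤ R := by exact_mod_cast (mem_squarefreeCoprime.1 hl).1
    rw [← h] at hzm
    linarith
  have hG := log_le_sum_totient_inv hg R
  set H := ∏ p ∈ g.primeFactors, (1 + (p : ℝ)⁻¹)
  set G := ∑ l ∈ S, (Nat.totient l : ℝ)⁻¹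
  have hGpos : 0 < G := sum_totient_inv_pos h1
  have hlog : 0 < Real.log (R + 1) := Real.log_pos (by
    have : (1 : ℝ) ≤ R := by exact_mod_cast hR
    linarith)
  calc ((dyadicPrimesModOne z g).card : ℝ) ≤ ((b : ℝ) - a) / G + (R : ℝ) ^ 4 :=
        le_trans (by exact_mod_cast hcard.trans hsub) hsieve
    _ ≤ _ := by
      gcongr ?_ + _
      rw [div_le_div_iff₀ hGpos hlog]
      calc ((b : ℝ) - a) * Real.log (R + 1) ≤ (z / g + 1) * (2 * (H * G)) := by
            gcongr
        _ = _ := by ring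

theorem card_dyadicPrimesModOne_sq_le {z : ℝ} (hz : 1 < z) {g : ℕ} (hg : g ≠ 0)
    (hgz : (g : ℝ) ≤ z) :
    ((dyadicPrimesModOne z g).card : ℝ) ^ 2 ≤
      102400 * (1 + Real.log g) * (z / Real.log z) ^ 2 * ((g : ℝ) ^ 2)⁻¹ + 2 * z := by
  have hz0 : 0 < z := by linarith
  have hlz : 0 < Real.log z := Real.log_pos hz
  have hg0 : (0 : ℝ) < g := by exact_mod_cast Nat.pos_of_ne_zero hg
  -- Sieving up to `z ^ (1/8)` loses only a factor `8` in the logarithm and keeps the squared error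
  -- `(R ^ 4) ^ 2` below `z`.
  set t : ℝ := z ^ (1 / 8 : ℝ) with ht
  have ht0 : 0 ≤ t := by positivity
  have ht1 : 1 ≤ t := Real.one_le_rpow hz.le (by norm_num)
  have htz : t < z := by
    calc t < z ^ (1 : ℝ) := Real.rpow_lt_rpow_of_exponent_lt hz (by norm_num)
      _ = z := Real.rpow_one z
  have ht8 : t ^ 8 = z := by
    rw [ht, ← Real.rpow_natCast, ← Real.rpow_mul hz0.le]; norm_num
  have hlt : Real.log t = Real.log z / 8 := by
    rw [ht, Real.log_rpow hz0]; ring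
  have hRle : (⌊t⌋₊ : ℝ) ≤ t := Nat.floor_le ht0
  have hR1 : 1 ≤ ⌊t⌋₊ := Nat.one_le_floor_iff t |>.2 ht1
  have hsieve := card_dyadicPrimesModOne_le_sieve hz.le hg hR1 (hRle.trans_lt htz)
  have hH := prod_primeFactors_one_add_inv_sq_le hg
  set H := ∏ p ∈ g.primeFactors, (1 + (p : ℝ)⁻¹)
  have hH0 : 0 ≤ H := Finset.prod_nonneg fun _ _ => by positivity
  have hlR : Real.log z / 8 ≤ Real.log (⌊t⌋₊ + 1) := by
    rw [← hlt]
    exact Real.log_le_log (by linarith) (Nat.lt_floor_add_one t).le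
  have hzg : 1 ≤ z / g := (one_le_div hg0).2 hgz
  have hN : ((dyadicPrimesModOne z g).card : ℝ) ≤ 32 * H * (z / Real.log z) * (g : ℝ)⁻¹ + t ^ 4 := by
    refine hsieve.trans ?_
    gcongr ?_ + ?_
    · calc _ ≤ (z / g + z / g) * (2 * H) / (Real.log z / 8) := by gcongr
        _ = _ := by field_simp; ring
    · gcongr
  calc ((dyadicPrimesModOne z g).card : ℝ) ^ 2
      ≤ (32 * H * (z / Real.log z) * (g : ℝ)⁻¹ + t ^ 4) ^ 2 := by gcongr
    _ ≤ 2 * ((32 * H * (z / Real.log z) * (g : ℝ)⁻¹) ^ 2 + (t ^ 4) ^ 2) := add_sq_le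
    _ = 2048 * H ^ 2 * ((z / Real.log z) ^ 2 * ((g : ℝ) ^ 2)⁻¹) + 2 * t ^ 8 := by
        field_simp; ring
    _ ≤ 2048 * (50 * (1 + Real.log g)) * ((z / Real.log z) ^ 2 * ((g : ℝ) ^ 2)⁻¹) + 2 * t ^ 8 := by
        gcongr
    _ = _ := by rw [ht8]; ring

/-! ### Passing from pairs to a sum over the gcd. -/

theorem card_largeGcdPairs_le_sum {z : ℝ} (hz : 1 ≤ z) :
    ((largeGcdPairs z).card : ℝ) ≤
      ∑ g ∈ Finset.Ioc ⌊Real.log z⌋₊ ⌊2 * z⌋₊, ((dyadicPrimesModOne z g).card : ℝ) ^ 2 := by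
  have hsub : largeGcdPairs z ⊆ (Finset.Ioc ⌊Real.log z⌋₊ ⌊2 * z⌋₊).biUnion
      fun g => dyadicPrimesModOne z g ×ˢ dyadicPrimesModOne z g := by
    rintro ⟨p, q⟩ h
    obtain ⟨hpq, hg⟩ := Finset.mem_filter.1 h
    obtain ⟨hp, hq⟩ := Finset.mem_product.1 hpq
    simp only at hp hq hg
    obtain ⟨hpp, -, hp2⟩ := mem_dyadicPrimes.1 hp
    refine Finset.mem_biUnion.2 ⟨Nat.gcd (p - 1) (q - 1), Finset.mem_Ioc.2 ⟨?_, ?_⟩, ?_⟩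
    · exact (Nat.floor_lt (Real.log_nonneg hz)).2 hg
    · apply Nat.le_floor
      have : Nat.gcd (p - 1) (q - 1) ≤ p :=
        (Nat.gcd_le_left _ (Nat.sub_pos_of_lt hpp.one_lt)).trans (Nat.sub_le p 1)
      have : (Nat.gcd (p - 1) (q - 1) : ℝ) ≤ p := by exact_mod_cast this
      linarith
    · exact Finset.mem_product.2 ⟨Finset.mem_filter.2 ⟨hp, Nat.gcd_dvd_left _ _⟩,
        Finset.mem_filter.2 ⟨hq, Nat.gcd_dvd_right _ _⟩⟩
  have := (Finset.card_le_card hsub).trans Finset.card_biUnion_le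
  simp only [Finset.card_product, ← sq] at this
  exact_mod_cast this

/-! ### Chebyshev's lower bound for primes in `[z, 2z)`. -/

/-- Erdős's argument: prime powers in the central binomial are at most `2n`, primes above `√(2n)`
occur at most once, and those in `(2n/3, n]` not at all. The primes up to `2n/3` are bounded by the
primorial. -/
theorem centralBinom_le_mul_pow_card_primes {n : ℕ} (hn : 2 < n) :
    n.centralBinom ≤ (2 * n) ^ Nat.sqrt (2 * n) * 4 ^ (2 * n / 3) *
      (2 * n) ^ ((Finset.Ioc n (2 * n)).filter Nat.Prime).card := by
  have h2n : 1 ≤ 2 * n := by omega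
  have hpt : ∀ p ∈ Finset.range (2 * n + 1), p ^ n.centralBinom.factorization p ≤
      (if p.Prime ∧ p ≤ Nat.sqrt (2 * n) then 2 * n else 1) *
        (if p.Prime ∧ p ≤ 2 * n / 3 then p else 1) * (if p.Prime ∧ n < p then 2 * n else 1) := by
    intro p _
    by_cases hp : p.Prime
    swap
    · simp [Nat.factorization_eq_zero_of_not_prime _ hp, hp]
    have hle : p ^ n.centralBinom.factorization p ≤ 2 * n :=
      Nat.pow_factorization_choose_le (by omega)
    have hp1 := hp.one_lt
    by_cases h1 : p ≤ Nat.sqrt (2 * n)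
    · have hb : 1 ≤ if p.Prime ∧ p ≤ 2 * n / 3 then p else 1 := by split_ifs <;> omega
      have hc : 1 ≤ if p.Prime ∧ n < p then 2 * n else 1 := by split_ifs <;> omega
      rw [if_pos ⟨hp, h1⟩, mul_assoc]
      exact hle.trans (Nat.le_mul_of_pos_right _ (Nat.mul_pos hb hc))
    · have hone : n.centralBinom.factorization p ≤ 1 :=
        Nat.factorization_choose_le_one (Nat.sqrt_lt'.1 (not_le.1 h1))
      by_cases h3 : n < p
      · rw [if_neg (fun h => h1 h.2), if_neg (fun h => by omega), if_pos ⟨hp, h3⟩]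
        simpa using hle
      by_cases h2 : p ≤ 2 * n / 3
      · rw [if_neg (fun h => h1 h.2), if_pos ⟨hp, h2⟩, if_neg (fun h => h3 h.2)]
        simpa using Nat.pow_le_pow_right hp1.le hone
      · rw [Nat.factorization_centralBinom_of_two_mul_self_lt_three_mul hn (not_lt.1 h3) (by omega)]
        simp [h1, h2, h3]
  rw [← Nat.prod_pow_factorization_centralBinom n]
  refine (Finset.prod_le_prod' hpt).trans ?_
  rw [Finset.prod_mul_distrib, Finset.prod_mul_distrib, ← Finset.prod_filter, ← Finset.prod_filter,
    ← Finset.prod_filter, Finset.prod_const, Finset.prod_const]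
  refine Nat.mul_le_mul (Nat.mul_le_mul ?_ ?_) ?_
  · refine Nat.pow_le_pow_right h2n ?_
    calc _ ≤ (Finset.Icc 1 (Nat.sqrt (2 * n))).card := by
          refine Finset.card_le_card fun p hp => ?_
          obtain ⟨-, hpp, hps⟩ := Finset.mem_filter.1 hp
          exact Finset.mem_Icc.2 ⟨hpp.one_lt.le, hps⟩
      _ = _ := by simp
  · refine le_trans ?_ (primorial_le_four_pow (2 * n / 3))
    refine Finset.prod_le_prod_of_subset_of_one_le' (fun p hp => ?_) fun p hp _ =>
      (Finset.mem_filter.1 hp).2.one_lt.le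
    obtain ⟨-, hpp, hps⟩ := Finset.mem_filter.1 hp
    exact Finset.mem_filter.2 ⟨Finset.mem_range.2 (by omega), hpp⟩
  · refine Nat.pow_le_pow_right h2n (Finset.card_le_card fun p hp => ?_)
    obtain ⟨hr, hpp, hps⟩ := Finset.mem_filter.1 hp
    exact Finset.mem_filter.2 ⟨Finset.mem_Ioc.2 ⟨hps, by simpa [Nat.lt_succ_iff] using hr⟩, hpp⟩

theorem log_four_mul_le_card_primes_mul_log {n : ℕ} (hn : 4 ≤ n) :
    (n : ℝ) / 3 * Real.log 4 ≤ (√(2 * n) + 1 +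
      ((Finset.Ioc n (2 * n)).filter Nat.Prime).card) * Real.log (2 * n) := by
  set N := ((Finset.Ioc n (2 * n)).filter Nat.Prime).card
  have hn0 : (0 : ℝ) < n := by positivity
  have h1 : 4 ^ n ≤ 2 * n * ((2 * n) ^ Nat.sqrt (2 * n) * 4 ^ (2 * n / 3) * (2 * n) ^ N) := by
    calc 4 ^ n ≤ n * n.centralBinom := (Nat.four_pow_lt_mul_centralBinom n hn).le
      _ ≤ _ := Nat.mul_le_mul (by omega) (centralBinom_le_mul_pow_card_primes (by omega))
  have h2 : ((4 : ℝ)) ^ n ≤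
      2 * n * ((2 * n) ^ Nat.sqrt (2 * n) * 4 ^ (2 * n / 3) * (2 * n) ^ N) := by
    exact_mod_cast h1
  have h3 := Real.log_le_log (by positivity) h2
  have hne : (2 * (n : ℝ)) ≠ 0 := by positivity
  rw [Real.log_pow, Real.log_mul hne (by positivity),
    Real.log_mul (x := _ * _) (by positivity) (by positivity),
    Real.log_mul (x := _ ^ _) (by positivity) (by positivity), Real.log_pow, Real.log_pow, Real.log_pow] at h3
  have hlog : 0 ≤ Real.log (2 * n) := Real.log_nonneg (by
    have : (4 : ℝ) ≤ n := by exact_mod_cast hn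
    linarith)
  have hl4 : 0 ≤ Real.log 4 := Real.log_nonneg (by norm_num)
  have hs : (Nat.sqrt (2 * n) : ℝ) ≤ √(2 * n) := by
    have := Real.nat_sqrt_le_real_sqrt (a := 2 * n)
    push_cast at this
    exact this
  have hd : ((2 * n / 3 : ℕ) : ℝ) ≤ 2 * n / 3 := by
    have := Nat.cast_div_le (α := ℝ) (m := 2 * n) (n := 3)
    push_cast at this
    exact this
  have h4 := mul_le_mul_of_nonneg_right hs hlog
  have h5 := mul_le_mul_of_nonneg_right hd hl4
  nlinarith

theorem eventually_le_card_dyadicPrimes :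
    ∀ᶠ z : ℝ in atTop, z / (6 * Real.log z) ≤ ((dyadicPrimes z).card : ℝ) := by
  have hs : Tendsto (fun z : ℝ => (2 * z) ^ (1 / 4 : ℝ)) atTop atTop :=
    (tendsto_rpow_atTop (by norm_num)).comp (tendsto_id.const_mul_atTop two_pos)
  filter_upwards [hs.eventually_ge_atTop 200, eventually_ge_atTop 10] with z hs200 hz10
  -- With `log (2z) = 4 log s ≤ 4s`, the error `√(2n) log (2n)` is at most `4 s ^ 3`, small against
  -- `s ^ 4 = 2z`.
  set s : ℝ := (2 * z) ^ (1 / 4 : ℝ) with hsdef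
  have hs4 : s ^ 4 = 2 * z := by
    rw [hsdef, ← Real.rpow_natCast, ← Real.rpow_mul (by linarith)]; norm_num
  have hs0 : 0 < s := by linarith
  have hlog2z : Real.log (2 * z) = 4 * Real.log s := by
    rw [← hs4, Real.log_pow]; norm_num
  have hlogs : Real.log s ≤ s := (Real.log_le_sub_one_of_pos hs0).trans (by linarith)
  have hlz : 0 < Real.log z := Real.log_pos (by linarith)
  -- With `n = ⌈z⌉ - 1 < z`, integers in `(n, 2n]` lie in `[z, 2z)`.
  obtain ⟨n, hn⟩ : ∃ n, ⌈z⌉₊ = n + 1 :=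
    Nat.exists_eq_succ_of_ne_zero (Nat.ceil_pos.2 (by linarith)).ne'
  have hnz : (n : ℝ) < z := Nat.lt_ceil.1 (by omega)
  have hzn : z ≤ n + 1 := by
    have := Nat.le_ceil z
    rw [hn] at this
    exact_mod_cast this
  have hn4 : 4 ≤ n := by
    have : (4 : ℝ) ≤ n := by linarith
    exact_mod_cast this
  have hsub : (Finset.Ioc n (2 * n)).filter Nat.Prime ⊆ dyadicPrimes z := by
    intro p hp
    obtain ⟨hp1, hpp⟩ := Finset.mem_filter.1 hp
    obtain ⟨h1, h2⟩ := Finset.mem_Ioc.1 hp1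
    refine mem_dyadicPrimes.2 ⟨hpp, Nat.ceil_le.1 (by omega), ?_⟩
    have : (p : ℝ) ≤ 2 * n := by exact_mod_cast h2
    linarith
  have hcard : (((Finset.Ioc n (2 * n)).filter Nat.Prime).card : ℝ) ≤ (dyadicPrimes z).card := by
    exact_mod_cast Finset.card_le_card hsub
  have hmain := log_four_mul_le_card_primes_mul_log hn4
  set N := (((Finset.Ioc n (2 * n)).filter Nat.Prime).card : ℝ)
  have hN0 : 0 ≤ N := by positivity
  have hl4 : 1.38 < Real.log 4 := by
    rw [show (4 : ℝ) = 2 ^ 2 by norm_num, Real.log_pow]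
    have := Real.log_two_gt_d9
    push_cast
    linarith
  have hsq : √(2 * n) ≤ s ^ 2 := by
    apply Real.sqrt_le_iff.2 ⟨by positivity, ?_⟩
    calc (2 * (n : ℝ)) ≤ 2 * z := by linarith
      _ = _ := by rw [← hs4]; ring
  have hln : Real.log (2 * n) ≤ Real.log (2 * z) :=
    Real.log_le_log (by positivity) (by linarith)
  have hl2z : Real.log (2 * z) ≤ 2 * Real.log z := by
    rw [Real.log_mul two_ne_zero (by linarith)]
    have := Real.log_le_log two_pos (show (2 : ℝ) ≤ z by linarith)
    linarith
  have hupper : (√(2 * n) + 1 + N) * Real.log (2 * n) ≤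
      (s ^ 2 + 1) * (4 * s) + N * (2 * Real.log z) := by
    have hl0 : 0 ≤ Real.log (2 * n) := Real.log_nonneg (by
      have : (4 : ℝ) ≤ n := by exact_mod_cast hn4
      linarith)
    rw [add_mul]
    gcongr
    · exact hln.trans (by rw [hlog2z]; linarith)
    · exact hln.trans hl2z
  have hlower : (z - 1) / 3 * 1.38 ≤ (n : ℝ) / 3 * Real.log 4 := by
    gcongr
    linarith
  have hpoly : (s ^ 2 + 1) * (4 * s) + 1 ≤ s ^ 4 / 20 := by
    nlinarith [pow_pos hs0 2, pow_pos hs0 3, mul_nonneg (pow_pos hs0 3).le (sub_nonneg.2 hs200),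
      mul_nonneg (pow_pos hs0 2).le (sub_nonneg.2 hs200)]
  refine le_trans ?_ hcard
  rw [div_le_iff₀ (by positivity)]
  linarith

/-! ### Violating pairs and the final estimates. -/

theorem violatingPairs_subset_largeGcdPairs {z : ℝ} (hz : 2 < z) :
    violatingPairs z ⊆ largeGcdPairs z := by
  classical
  rintro ⟨p, q⟩ h
  rw [violatingPairs, Finset.mem_filter] at h
  obtain ⟨hpq, hviol⟩ := h
  refine Finset.mem_filter.2 ⟨hpq, ?_⟩
  obtain ⟨hp, hq⟩ := Finset.mem_product.1 hpq
  simp only [ReductionCondition, not_or, not_not] at hp hq hviol ⊢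
  obtain ⟨hpp, hzp, -⟩ := mem_dyadicPrimes.1 hp
  obtain ⟨hqp, hzq, -⟩ := mem_dyadicPrimes.1 hq
  have : Fact q.Prime := ⟨hqp⟩
  set g := Nat.gcd (p - 1) (q - 1) with hg
  have hq2 : 2 < q := by
    have : (2 : ℝ) < q := by linarith
    exact_mod_cast this
  have htwo : (2 : ZMod q) ≠ 0 := by
    intro h0
    have : ((2 : ℕ) : ZMod q) = 0 := by exact_mod_cast h0
    exact absurd (Nat.le_of_dvd two_pos ((ZMod.natCast_eq_zero_iff 2 q).1 this)) (by omega)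
  have hpow1 : (2 : ZMod q) ^ (p - 1) = 1 := by
    have := (ZMod.natCast_eq_natCast_iff _ _ _).2 hviol.1
    exact_mod_cast this
  have hpow2 : (2 : ZMod q) ^ (q - 1) = 1 := ZMod.pow_card_sub_one_eq_one htwo
  have hpow : (2 : ZMod q) ^ g = 1 :=
    orderOf_dvd_iff_pow_eq_one.1
      (Nat.dvd_gcd (orderOf_dvd_of_pow_eq_one hpow1) (orderOf_dvd_of_pow_eq_one hpow2))
  have hg0 : g ≠ 0 := Nat.gcd_ne_zero_right (by omega)
  have hdvd : q ∣ 2 ^ g - 1 := by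
    rw [← ZMod.natCast_eq_zero_iff, Nat.cast_sub Nat.one_le_two_pow]
    push_cast
    rw [hpow, sub_self]
  have hqlt : q < 2 ^ g := by
    have h1 : 1 < 2 ^ g := Nat.one_lt_two_pow hg0
    have := Nat.le_of_dvd (by omega) hdvd
    omega
  have hzlt : z < 2 ^ g := hzq.trans_lt (by exact_mod_cast hqlt)
  have hlog := Real.log_lt_log (by linarith) hzlt
  rw [Real.log_pow] at hlog
  have hl2 := Real.log_two_lt_d9
  have : (0 : ℝ) ≤ g := by positivity
  nlinarith

theorem exists_eventually_card_largeGcdPairs_le :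
    ∃ C : ℝ, 0 < C ∧ ∀ᶠ z : ℝ in atTop, ((largeGcdPairs z).card : ℝ) ≤
      C * ((z / Real.log z) ^ 2 * (Real.log (Real.log z) / Real.log z)) := by
  refine ⟨1000000, by norm_num, ?_⟩
  have hL := Real.tendsto_log_atTop
  -- This absorbs the error `2z` summed over `g ≤ L ^ 3`, as `z * L ^ 3 ≤ z ^ 2 / L ^ 3`.
  have hpow : ∀ᶠ z : ℝ in atTop, Real.log z ^ 6 ≤ z := by
    have := (Real.isLittleO_pow_log_id_atTop (n := 6)).bound one_pos
    filter_upwards [this, eventually_ge_atTop 1] with z h hz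
    have h0 := Real.log_nonneg hz
    simpa [abs_of_nonneg h0, abs_of_nonneg (zero_le_one.trans hz)] using h
  filter_upwards [hpow, hL.eventually_ge_atTop 2, (hL.comp hL).eventually_ge_atTop 1,
    eventually_ge_atTop 2] with z hpow hL2 hLL hz2
  simp only [Function.comp_apply] at hLL
  set L := Real.log z with hLdef
  set LL := Real.log L with hLLdef
  have hz0 : 0 < z := by linarith
  have hL0 : 0 < L := by linarith
  have hL36 : L ^ 3 ≤ L ^ 6 := pow_le_pow_right₀ (by linarith) (by norm_num)
  set k := ⌊L⌋₊
  -- Up to `L ^ 3` the sieve is used, with `1 + log g ≤ 4 LL`; beyond it the trivial bound, where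
  -- the tail of `1 / g ^ 2` is already `O(1 / L ^ 3)`.
  set T := ⌊L ^ 3⌋₊
  set M := ⌊2 * z⌋₊
  have hk0 : k ≠ 0 := (Nat.floor_pos.2 (by linarith)).ne'
  have hLL3 : L ≤ L ^ 3 := le_self_pow₀ (by linarith) (by norm_num)
  have hkT : k ≤ T := Nat.floor_mono hLL3
  have hTM : T ≤ M := Nat.floor_mono (by linarith)
  have hT0 : T ≠ 0 := by omega
  have hfloor : ∀ x : ℝ, 2 ≤ x → (⌊x⌋₊ : ℝ)⁻¹ ≤ 2 / x := by
    intro x hx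
    have := Nat.lt_floor_add_one x
    rw [inv_eq_one_div, div_le_div_iff₀ (by linarith) (by linarith)]
    linarith
  have hT3 : (T : ℝ) ≤ L ^ 3 := Nat.floor_le (by positivity)
  have hsum1 : ∑ g ∈ Finset.Ioc k T, ((dyadicPrimesModOne z g).card : ℝ) ^ 2 ≤
      819200 * (LL * (z ^ 2 / L ^ 3)) + 2 * (z ^ 2 / L ^ 3) := by
    calc _ ≤ ∑ g ∈ Finset.Ioc k T,
          (409600 * LL * (z / L) ^ 2 * ((g : ℝ) ^ 2)⁻¹ + 2 * z) := by
          refine Finset.sum_le_sum fun g hg => ?_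
          obtain ⟨hg1, hg2⟩ := Finset.mem_Ioc.1 hg
          have hg0 : g ≠ 0 := by omega
          have hgT : (g : ℝ) ≤ L ^ 3 := le_trans (by exact_mod_cast hg2) hT3
          refine (card_dyadicPrimesModOne_sq_le (by linarith) hg0 (by linarith)).trans ?_
          have hlg : Real.log g ≤ 3 * LL := by
            have := Real.log_le_log (by exact_mod_cast Nat.pos_of_ne_zero hg0) hgT
            rw [Real.log_pow] at this
            exact_mod_cast this
          have hfac : 102400 * (1 + Real.log g) ≤ 409600 * LL := by linarith
          rw [← hLdef]
          gcongr
      _ = 409600 * LL * (z / L) ^ 2 * ∑ g ∈ Finset.Ioc k T, ((g : ℝ) ^ 2)⁻¹ +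
          ((T : ℝ) - k) * (2 * z) := by
          rw [Finset.sum_add_distrib, ← Finset.mul_sum, Finset.sum_const, Nat.card_Ioc,
            nsmul_eq_mul, Nat.cast_sub hkT]
      _ ≤ 409600 * LL * (z / L) ^ 2 * (2 / L) + L ^ 3 * (2 * z) := by
          have h1 := sum_Ioc_inv_sq_le_sub (α := ℝ) hk0 hkT
          have h2 := hfloor L hL2
          have h3 : (0 : ℝ) ≤ (T : ℝ)⁻¹ := by positivity
          gcongr
          · exact h1.trans ((sub_le_self _ h3).trans h2)
          · exact (sub_le_self _ (by positivity)).trans hT3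
      _ = 819200 * (LL * (z ^ 2 / L ^ 3)) + 2 * (L ^ 6 * z / L ^ 3) := by
          field_simp; ring
      _ ≤ _ := by
          rw [sq z]
          gcongr
  have hsum2 : ∑ g ∈ Finset.Ioc T M, ((dyadicPrimesModOne z g).card : ℝ) ^ 2 ≤
      18 * (z ^ 2 / L ^ 3) := by
    calc _ ≤ ∑ g ∈ Finset.Ioc T M, 9 * z ^ 2 * ((g : ℝ) ^ 2)⁻¹ := by
          refine Finset.sum_le_sum fun g hg => ?_
          obtain ⟨hg1, hg2⟩ := Finset.mem_Ioc.1 hg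
          have hg0 : g ≠ 0 := by omega
          have hgpos : (0 : ℝ) < g := by exact_mod_cast Nat.pos_of_ne_zero hg0
          have hgz : (g : ℝ) ≤ 2 * z := (Nat.le_floor_iff (by linarith)).1 hg2
          have hone : 1 ≤ 2 * z / g := (one_le_div hgpos).2 hgz
          calc ((dyadicPrimesModOne z g).card : ℝ) ^ 2 ≤ (z / g + 2 * z / g) ^ 2 := by
                gcongr
                exact (card_dyadicPrimesModOne_le (by linarith) hg0).trans (by gcongr)
            _ = _ := by field_simp; ring
      _ ≤ 9 * z ^ 2 * (2 / L ^ 3) := by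
          rw [← Finset.mul_sum]
          have h1 := sum_Ioc_inv_sq_le_sub (α := ℝ) hT0 hTM
          have h2 := hfloor (L ^ 3) (by linarith)
          have h3 : (0 : ℝ) ≤ (M : ℝ)⁻¹ := by positivity
          gcongr
          exact h1.trans ((sub_le_self _ h3).trans h2)
      _ = _ := by ring
  have hsplit : ∑ g ∈ Finset.Ioc k M, ((dyadicPrimesModOne z g).card : ℝ) ^ 2 =
      ∑ g ∈ Finset.Ioc k T, ((dyadicPrimesModOne z g).card : ℝ) ^ 2 +
        ∑ g ∈ Finset.Ioc T M, ((dyadicPrimesModOne z g).card : ℝ) ^ 2 :=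
    (Finset.sum_Ioc_consecutive _ hkT hTM).symm
  have hcard := card_largeGcdPairs_le_sum (z := z) (by linarith)
  have hA : z ^ 2 / L ^ 3 ≤ LL * (z ^ 2 / L ^ 3) := le_mul_of_one_le_left (by positivity) hLL
  have hfin : (z / L) ^ 2 * (LL / L) = LL * (z ^ 2 / L ^ 3) := by field_simp
  have hpos : 0 ≤ LL * (z ^ 2 / L ^ 3) := by positivity
  rw [hfin]
  linarith

theorem proposition1 :
    (∃ z₀ : ℝ, ∀ z : ℝ, z₀ ≤ z →
      ((largeGcdPairs z).card : ℝ) ≤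
        (z / Real.log z) ^ 2 * ((Real.log (Real.log z)) ^ 2 / Real.log z)) ∧
    (fun z : ℝ => ((violatingPairs z).card : ℝ) / ((primePairs z).card : ℝ)) =o[atTop]
      (fun z : ℝ => (Real.log (Real.log z)) ^ 2 / Real.log z) := by
  obtain ⟨C, hC, hmain⟩ := exists_eventually_card_largeGcdPairs_le
  have hL := Real.tendsto_log_atTop
  have hLL := hL.comp hL
  constructor
  · refine eventually_atTop.1 ?_
    filter_upwards [hmain, hLL.eventually_ge_atTop C, hL.eventually_gt_atTop 0] with z h hC' hL0
    simp only [Function.comp_apply] at hC'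
    refine h.trans ?_
    calc C * ((z / Real.log z) ^ 2 * (Real.log (Real.log z) / Real.log z))
        = (z / Real.log z) ^ 2 * (C * Real.log (Real.log z) / Real.log z) := by ring
      _ ≤ _ := by
        rw [sq (Real.log (Real.log z))]
        gcongr
        exact hC.le.trans hC'
  · refine isLittleO_iff.2 fun c hc => ?_
    -- The `36` is the square of the `6` in the Chebyshev bound.
    filter_upwards [hmain, hLL.eventually_ge_atTop (36 * C / c), hL.eventually_gt_atTop 0,
      eventually_gt_atTop 2, eventually_le_card_dyadicPrimes] with z h hC' hL0 hz hP
    simp only [Function.comp_apply] at hC'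
    set L := Real.log z
    set LL := Real.log L
    have hz0 : 0 < z := by linarith
    have hLL0 : 0 ≤ LL := le_trans (by positivity) hC'
    have hpairs : (z / (6 * L)) ^ 2 ≤ ((primePairs z).card : ℝ) := by
      rw [primePairs, Finset.card_product, Nat.cast_mul, ← sq]
      gcongr
    have hviol : ((violatingPairs z).card : ℝ) ≤ C * ((z / L) ^ 2 * (LL / L)) :=
      le_trans (by exact_mod_cast Finset.card_le_card (violatingPairs_subset_largeGcdPairs hz)) h
    rw [Real.norm_of_nonneg (by positivity), Real.norm_of_nonneg (by positivity)]
    calc ((violatingPairs z).card : ℝ) / ((primePairs z).card : ℝ)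
        ≤ C * ((z / L) ^ 2 * (LL / L)) / (z / (6 * L)) ^ 2 := by gcongr
      _ = c * ((36 * C / c) * LL / L) := by field_simp; ring
      _ ≤ _ := by
        rw [sq LL]
        gcongr
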